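/- Let $K$ be an algebraically closed field, $n \ge 2$, and let $A = (A_1,\dots,A_n)$ be a tuple of $3\times 4$-matrices of rank $3$ with entries in $K$. The focal point $f_i \in \mathbb{P}^3$ of $A_i$ is the point represented by a generator of the kernel of $A_i$. Let $V_A \subseteq (\mathbb{P}^2)^n$ be the Zariski closure of the image of the rational map $$\phi_A : \mathbb{P}^3 \dashrightarrow (\mathbb{P}^2)^n,\qquad \mathbf{x} \mapsto (A_1\mathbf{x},\dots,A_n\mathbf{x}),$$ which is defined on $\mathbb{P}^3\setminus\{f_1,\dots,f_n\}$, and let the multiview ideal $J_A \subset K[x,y,z] = K[x_i,y_i,z_i : 1\le i\le n]$ be the ideal of all polynomials that vanish on $V_A$. Grade $K[x,y,z]$ by $\mathbb{Z}^n$ with $\deg(x_i)=\deg(y_i)=\deg(z_i)=e_i$, the $i$-th standard unit vector, and for $u\in\mathbb{N}^n$ let $(K[x,y,z]/J_A)_u$ denote the degree-$u$ component of the quotient, that is, the image of the space of homogeneous polynomials of degree $u$. Then the Hilbert function of $K[x,y,z]/J_A$ is given by $$\dim_K \bigl(K[x,y,z]/J_A\bigr)_u = \binom{u_1+\cdots+u_n+3}{3}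 - \sum_{i=1}^n \binom{u_i+2}{3}\qquad\text{for all } u=(u_1,\dots,u_n)\in\mathbb{N}^n$$ if and only if the focal points $f_1,\dots,f_n$ are pairwise distinct. -/

import Mathlib

open scoped LinearAlgebra.Projectivization Matrix

namespace Multiview

section Camera

variable {K : Type*} [Field K]

/-- A camera matrix of rank `3` has a one-dimensional kernel. -/
theorem finrank_ker_camera (M : Matrix (Fin 3) (Fin 4) K) (hM : M.rank = 3) :
    Module.finrank K (LinearMap.ker M.mulVecLin) = 1 := by
  have h := M.mulVecLin.finrank_range_add_finrank_ker
  have h3 : Module.finrank K (LinearMap.range M.mulVecLin) = 3 := hM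
  rw [h3] at h
  simp at h
  omega

/-- The focal point of a camera matrix of rank `3`: its kernel, as a point of `ℙ³`. -/
noncomputable def focalPoint (M : Matrix (Fin 3) (Fin 4) K) (hM : M.rank = 3) :
    ℙ K (Fin 4 → K) :=
  Projectivization.mk'' (LinearMap.ker M.mulVecLin) (finrank_ker_camera M hM)

end Camera

/-- The set of points of `(ℙ²)ⁿ`. -/
abbrev ProdPlanes (K : Type*) [Field K] (n : ℕ) : Type _ := Fin n → ℙ K (Fin 3 → K)

/-- The polynomial ring in the `3n` unknowns `x_i, y_i, z_i`; the variables indexed by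
`(i, 0)`, `(i, 1)`, `(i, 2)` are `x_i`, `y_i`, `z_i`. -/
abbrev CoordRing (K : Type*) [Field K] (n : ℕ) : Type _ := MvPolynomial (Fin n × Fin 3) K

/-- The multidegree: `x_i`, `y_i`, `z_i` all have degree `e_i`. -/
def varDegree (n : ℕ) : Fin n × Fin 3 → (Fin n → ℕ) := fun p => Pi.single p.1 1

section Geometry

variable {K : Type*} [Field K] {n : ℕ}

/-- The vector `v = (v_1, …, v_n)` consists of homogeneous coordinates of the point `P` of
`(ℙ²)ⁿ`. -/
def Represents (v : Fin n → Fin 3 → K) (P : ProdPlanes K n) : Prop :=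
  ∀ i, ∃ h : v i ≠ 0, Projectivization.mk K (v i) h = P i

/-- The polynomial `F` vanishes at the point `P` of `(ℙ²)ⁿ`, for every choice of homogeneous
coordinates. -/
def VanishesAt (F : CoordRing K n) (P : ProdPlanes K n) : Prop :=
  ∀ v : Fin n → Fin 3 → K, Represents v P → MvPolynomial.eval (fun p => v p.1 p.2) F = 0

/-- The ideal of all polynomials that vanish at every point of a subset of `(ℙ²)ⁿ`. -/
def idealOf (V : Set (ProdPlanes K n)) : Ideal (CoordRing K n) where
  carrier := {F | ∀ P ∈ V, VanishesAt F P}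
  zero_mem' := fun _ _ _ _ => map_zero _
  add_mem' := fun hF hG P hP v hv => by rw [map_add, hF P hP v hv, hG P hP v hv, add_zero]
  smul_mem' := fun c F hF P hP v hv => by
    rw [smul_eq_mul, map_mul, hF P hP v hv, mul_zero]

/-- Zariski closed subsets of `(ℙ²)ⁿ`: the common zero sets of families of multihomogeneous
polynomials. -/
def IsZariskiClosed (V : Set (ProdPlanes K n)) : Prop :=
  ∃ S : Set (CoordRing K n),
    (∀ F ∈ S, ∃ u : Fin n → ℕ, MvPolynomial.IsWeightedHomogeneous (varDegree n) F u) ∧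
      V = {P | ∀ F ∈ S, VanishesAt F P}

/-- The Zariski closure in `(ℙ²)ⁿ`: the intersection of all Zariski closed sets that contain
the given set. -/
def zariskiClosure (T : Set (ProdPlanes K n)) : Set (ProdPlanes K n) :=
  ⋂₀ {V | IsZariskiClosed V ∧ T ⊆ V}

/-- The image of the rational map `ℙ³ ⇢ (ℙ²)ⁿ`, `x ↦ (A_1 x, …, A_n x)`, on its domain of
definition `{x | A_i x ≠ 0 for all i}`. -/
def cameraImage (A : Fin n → Matrix (Fin 3) (Fin 4) K) : Set (ProdPlanes K n) :=
  {P | ∃ x : Fin 4 → K, x ≠ 0 ∧ ∃ h : ∀ i, A i *ᵥ x ≠ 0,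
    P = fun i => Projectivization.mk K (A i *ᵥ x) (h i)}

/-- The multiview variety: the Zariski closure of the image. -/
def multiviewVariety (A : Fin n → Matrix (Fin 3) (Fin 4) K) : Set (ProdPlanes K n) :=
  zariskiClosure (cameraImage A)

/-- The multiview ideal: all polynomials that vanish on the multiview variety. -/
def multiviewIdeal (A : Fin n → Matrix (Fin 3) (Fin 4) K) : Ideal (CoordRing K n) :=
  idealOf (multiviewVariety A)

/-- The `ℤⁿ`-graded Hilbert function of `K[x,y,z]/J`, at `u ∈ ℕⁿ`: the dimension of the
degree `u` part of the quotient, which is the image of the space of polynomials of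
multidegree `u`. -/
noncomputable def hilbertFunction (J : Ideal (CoordRing K n)) (u : Fin n → ℕ) : ℕ :=
  Module.finrank K
    ((MvPolynomial.weightedHomogeneousSubmodule K (varDegree n) u).map
      (Ideal.Quotient.mkₐ K J).toLinearMap)

end Geometry

end Multiview

/-! Substituting `A_i x` for the `i`-th block of variables turns the Hilbert function into a count
of forms on `ℙ³`. A multihomogeneous `F` lies in the multiview ideal iff `F(A_1 x, …, A_n x) = 0`
(`mem_multiviewIdeal_iff`), and the rows of `A_i` span the linear forms vanishing at `f_i`. So the
value at `u` is the dimension of `P_u = ∏ L_i ^ u_i` (`productSpace`), where `L_i` is the space of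
linear forms vanishing at `f_i` (`hilbertFunction_multiviewIdeal`).

If the `f_i` are distinct, choose a plane `c = 0` through `f_i` that avoids the other focal points.
Restriction to it gives an exact sequence `0 → P_u → P_{u+e_i} → W → 0`, whose first map is
multiplication by `c`. Here `W` consists of the plane forms of degree `∑ u + 1` vanishing to order
`u_i + 1` at one point. Exactness in the middle requires `c G ∈ P_{u+e_i}` to imply `G ∈ P_u`. This
is clear for the larger space of forms with prescribed vanishing orders at the `f_k` (`fatSpace`),
and the same restriction argument shows by induction that the two spaces agree
(`Separated.fatSpace_eq`). Counting monomials in `W` and summing with Pascal's rule gives the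
formula.

If `f_i = f_j` with `i ≠ j`, then at `u = e_i + e_j` the space `L_i * L_i` has dimension at most 6,
whereas the formula predicts `10 - 2 = 8`. -/

namespace Multiview

open MvPolynomial Module

/-! ### Linear forms and those vanishing at a point -/

section LinearForms

variable {K : Type*} [Field K] {ι : Type*} [Fintype ι]

/-- The linear form with a given coefficient vector. -/
noncomputable def linearForm (K : Type*) [Field K] (ι : Type*) [Fintype ι] :
    (ι → K) →ₗ[K] MvPolynomial ι K :=
  Fintype.linearCombination K (fun j => (X j : MvPolynomial ι K))

theorem linearForm_apply (c : ι → K) :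
    linearForm K ι c = ∑ j, C (c j) * X j := by
  simp [linearForm, Fintype.linearCombination_apply, MvPolynomial.smul_eq_C_mul]

theorem eval_linearForm (c x : ι → K) : eval x (linearForm K ι c) = c ⬝ᵥ x := by
  simp [linearForm_apply, dotProduct]

theorem linearForm_isHomogeneous (c : ι → K) : (linearForm K ι c).IsHomogeneous 1 := by
  rw [linearForm_apply]
  exact IsHomogeneous.sum _ _ _ fun j _ => isHomogeneous_C_mul_X _ _

theorem aeval_linearForm {R : Type*} [CommRing R] [Algebra K R] (g : ι → R) (c : ι → K) :
    aeval g (linearForm K ι c) = ∑ j, c j • g j := by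
  simp [linearForm, Fintype.linearCombination_apply]

theorem linearForm_single [DecidableEq ι] (j : ι) :
    linearForm K ι (Pi.single j 1) = X j := by
  simp [linearForm, Fintype.linearCombination_apply, Pi.single_apply]

theorem linearForm_ne_zero {c : ι → K} (hc : c ≠ 0) : linearForm K ι c ≠ 0 := by
  classical
  intro h
  apply hc
  ext j
  have := eval_linearForm c (Pi.single j 1)
  simpa [h] using this.symm

theorem range_linearForm :
    LinearMap.range (linearForm K ι) = homogeneousSubmodule ι K 1 := by
  rw [linearForm, Fintype.range_linearCombination, homogeneousSubmodule_one_eq_span_X]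

/-- The space of linear forms that vanish at a given vector. -/
noncomputable def formsAt (f : ι → K) : Submodule K (MvPolynomial ι K) :=
  (LinearMap.ker (dotProductBilin K K f)).map (linearForm K ι)

theorem mem_formsAt {f : ι → K} {F : MvPolynomial ι K} :
    F ∈ formsAt f ↔ ∃ c : ι → K, c ⬝ᵥ f = 0 ∧ linearForm K ι c = F := by
  simp [formsAt, dotProduct_comm]

theorem linearForm_mem_formsAt {f c : ι → K} (h : c ⬝ᵥ f = 0) :
    linearForm K ι c ∈ formsAt f := mem_formsAt.2 ⟨c, h, rfl⟩

theorem formsAt_le (f : ι → K) : formsAt f ≤ homogeneousSubmodule ι K 1 := by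
  rw [← range_linearForm]
  exact LinearMap.map_le_range

end LinearForms

/-! ### Vanishing order, measured as degree along a direction -/

section Translation

variable {K : Type*} [Field K] {ι : Type*}

/-- Translation by a generic multiple of `f`: the substitution `x ↦ x + t f`. -/
noncomputable def translate (f : ι → K) :
    MvPolynomial ι K →ₐ[K] Polynomial (MvPolynomial ι K) :=
  aeval fun j => Polynomial.C (X j) + Polynomial.C (C (f j)) * Polynomial.X

/-- Polynomials that have degree at most `m` along every line with direction `f`. -/
noncomputable def degreeAlongLE (f : ι → K) (m : ℕ) : Submodule K (MvPolynomial ι K) :=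
  ((Polynomial.degreeLE (MvPolynomial ι K) m).restrictScalars K).comap
    (translate f).toLinearMap

theorem mem_degreeAlongLE {f : ι → K} {m : ℕ} {F : MvPolynomial ι K} :
    F ∈ degreeAlongLE f m ↔ (translate f F).natDegree ≤ m := by
  simp [degreeAlongLE, Polynomial.mem_degreeLE, Polynomial.natDegree_le_iff_degree_le]

variable [Fintype ι]

theorem translate_linearForm (f c : ι → K) :
    translate f (linearForm K ι c) =
      Polynomial.C (linearForm K ι c) + Polynomial.C (C (c ⬝ᵥ f)) * Polynomial.X := by
  rw [translate, aeval_linearForm, linearForm_apply]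
  simp only [smul_add, Finset.sum_add_distrib, dotProduct, map_sum, Finset.sum_mul, map_mul]
  congr 1 <;> refine Finset.sum_congr rfl fun j _ => ?_
  · rw [Algebra.smul_def]; rfl
  · rw [Algebra.smul_def, ← mul_assoc]; rfl

theorem formsAt_le_degreeAlongLE_one (f g : ι → K) : formsAt g ≤ degreeAlongLE f 1 := by
  intro F hF
  obtain ⟨c, -, rfl⟩ := mem_formsAt.1 hF
  rw [mem_degreeAlongLE, translate_linearForm, add_comm]
  exact Polynomial.natDegree_linear_le

theorem formsAt_le_degreeAlongLE_zero (f : ι → K) : formsAt f ≤ degreeAlongLE f 0 := by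
  intro F hF
  obtain ⟨c, h, rfl⟩ := mem_formsAt.1 hF
  rw [mem_degreeAlongLE, translate_linearForm, h]
  simp

theorem natDegree_translate_mul_linearForm {f c : ι → K} (hc : c ⬝ᵥ f ≠ 0)
    {F : MvPolynomial ι K} (hF : translate f F ≠ 0) :
    (translate f (linearForm K ι c * F)).natDegree = (translate f F).natDegree + 1 := by
  have h1 : (translate f (linearForm K ι c)).natDegree = 1 := by
    rw [translate_linearForm, add_comm]
    exact Polynomial.natDegree_linear (by simpa using hc)
  have h2 : translate f (linearForm K ι c) ≠ 0 := by
    intro h; simp [h] at h1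
  rw [map_mul, Polynomial.natDegree_mul h2 hF, h1, add_comm]

theorem natDegree_translate_mul_linearForm_of_mem {f c : ι → K} (hc0 : c ≠ 0)
    (hc : c ⬝ᵥ f = 0) (F : MvPolynomial ι K) :
    (translate f (linearForm K ι c * F)).natDegree = (translate f F).natDegree := by
  rw [map_mul, translate_linearForm, hc]
  simp only [map_zero, zero_mul, add_zero]
  exact Polynomial.natDegree_C_mul (linearForm_ne_zero hc0)

end Translation

/-! ### Products of linear forms and forms with prescribed vanishing orders -/

section Products

variable {K : Type*} [Field K] {ι κ : Type*} [Fintype κ]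

/-- Forms of degree `∑ u` that vanish to order `u k` at `f k`. -/
noncomputable def fatSpace (f : κ → ι → K) (u : κ → ℕ) : Submodule K (MvPolynomial ι K) :=
  homogeneousSubmodule ι K (∑ k, u k) ⊓ ⨅ k, degreeAlongLE (f k) (∑ j, u j - u k)

/-- In coordinates where `f k` is a basis vector, a form of degree `d` vanishes to order `m` there
iff its degree in the matching variable is at most `d - m`. Measuring degree rather than derivatives
works in every characteristic. -/
theorem mem_fatSpace {f : κ → ι → K} {u : κ → ℕ} {F : MvPolynomial ι K} :
    F ∈ fatSpace f u ↔ F.IsHomogeneous (∑ k, u k) ∧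
      ∀ k, (translate (f k) F).natDegree + u k ≤ ∑ j, u j := by
  simp only [fatSpace, Submodule.mem_inf, Submodule.mem_iInf, mem_degreeAlongLE,
    mem_homogeneousSubmodule]
  refine and_congr_right fun _ => forall_congr' fun k => ?_
  have := Finset.single_le_sum (f := u) (fun j _ => Nat.zero_le _) (Finset.mem_univ k)
  omega

theorem fatSpace_zero_le (f : κ → ι → K) : fatSpace f 0 ≤ 1 := by
  intro F hF
  rw [← homogeneousSubmodule_zero]
  rw [mem_homogeneousSubmodule]
  simpa only [Pi.zero_apply, Finset.sum_const_zero] using (mem_fatSpace.1 hF).1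

variable [Fintype ι]

/-- The space spanned by the products of linear forms, `u k` of which vanish at `f k`. -/
noncomputable def productSpace (f : κ → ι → K) (u : κ → ℕ) : Submodule K (MvPolynomial ι K) :=
  ∏ k, formsAt (f k) ^ u k

theorem finiteDimensional_homogeneousSubmodule (d : ℕ) :
    FiniteDimensional K (homogeneousSubmodule ι K d) :=
  Module.Finite.iff_fg.2 (homogeneousSubmodule_fg ι K d)

theorem finiteDimensional_fatSpace (f : κ → ι → K) (u : κ → ℕ) :
    FiniteDimensional K (fatSpace f u) :=
  have := finiteDimensional_homogeneousSubmodule (K := K) (ι := ι) (∑ k, u k)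
  Submodule.finiteDimensional_of_le inf_le_left

theorem productSpace_zero (f : κ → ι → K) : productSpace f 0 = 1 := by
  simp [productSpace]

theorem productSpace_add_single [DecidableEq κ] (f : κ → ι → K) (u : κ → ℕ) (i : κ) :
    productSpace f (u + Pi.single i 1) = formsAt (f i) * productSpace f u := by
  simp only [productSpace, Pi.add_apply, pow_add, Finset.prod_mul_distrib]
  rw [mul_comm]
  congr 1
  rw [Finset.prod_eq_single i] <;> simp +contextual

theorem sum_add_single [DecidableEq κ] (u : κ → ℕ) (i : κ) :
    ∑ k, (u + Pi.single i 1 : κ → ℕ) k = ∑ k, u k + 1 := by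
  simp [Finset.sum_add_distrib]

theorem induction_add_single {motive : (κ → ℕ) → Prop} [DecidableEq κ] (zero : motive 0)
    (add : ∀ u i, motive u → motive (u + Pi.single i 1)) (u : κ → ℕ) : motive u := by
  obtain ⟨d, hd⟩ : ∃ d, ∑ k, u k = d := ⟨_, rfl⟩
  induction d generalizing u with
  | zero =>
    have : u = 0 := by ext k; simpa using (Finset.sum_eq_zero_iff.1 hd) k (Finset.mem_univ k)
    rwa [this]
  | succ d ih =>
    obtain ⟨i, -, hi⟩ := Finset.exists_ne_zero_of_sum_ne_zero (hd.trans_ne d.succ_ne_zero)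
    have hu : u = (u - Pi.single i 1) + Pi.single i 1 := by
      ext k
      rcases eq_or_ne k i with rfl | h
      · simp; omega
      · simp [h]
    rw [hu]
    refine add _ i (ih _ ?_)
    have := sum_add_single (u - Pi.single i 1) i
    rw [← hu] at this
    omega

theorem productSpace_le_fatSpace (f : κ → ι → K) (u : κ → ℕ) :
    productSpace f u ≤ fatSpace f u := by
  classical
  induction u using induction_add_single with
  | zero =>
    rw [productSpace_zero, Submodule.one_le, mem_fatSpace]
    simp [isHomogeneous_one]
  | add u i ih =>
    rw [productSpace_add_single, Submodule.mul_le]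
    intro l hl F hF
    obtain ⟨hF, hF'⟩ := mem_fatSpace.1 (ih hF)
    rw [mem_fatSpace, sum_add_single]
    refine ⟨add_comm 1 (∑ k, u k) ▸ (formsAt_le _ hl : l.IsHomogeneous 1).mul hF, fun k => ?_⟩
    rw [map_mul]
    have h := Polynomial.natDegree_mul_le (p := translate (f k) l) (q := translate (f k) F)
    have hk := hF' k
    rcases eq_or_ne k i with rfl | hki
    · have := mem_degreeAlongLE.1 (formsAt_le_degreeAlongLE_zero _ hl)
      simp only [Pi.add_apply, Pi.single_eq_same]
      omega
    · have := mem_degreeAlongLE.1 (formsAt_le_degreeAlongLE_one (f k) _ hl)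
      simp only [Pi.add_apply, Pi.single_eq_of_ne hki]
      omega

theorem finiteDimensional_productSpace (f : κ → ι → K) (u : κ → ℕ) :
    FiniteDimensional K (productSpace f u) :=
  have := finiteDimensional_fatSpace f u
  Submodule.finiteDimensional_of_le (productSpace_le_fatSpace f u)

end Products

/-! ### Restriction to a plane in `ℙ³` -/

section PlaneCharts

variable {K : Type*} [Field K]

/-- A linear parametrization `B` of the plane `c = 0` in `K⁴` that sends the first basis vector
to `f`, with a retraction `R` onto the plane that kills the complementary vector `b`. -/
structure PlaneChart (f c : Fin 4 → K) where
  B : Matrix (Fin 4) (Fin 3) K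
  R : Matrix (Fin 3) (Fin 4) K
  b : Fin 4 → K
  col_zero : B *ᵥ Pi.single 0 1 = f
  vecMul_eq : c ᵥ* B = 0
  retract : R * B = 1
  split : B * R + Matrix.vecMulVec b c = 1

/-- Take a basis of `K⁴` whose first vector `b` satisfies `c ⬝ᵥ b = 1` and whose others form a basis
of the plane starting with `f`. Then `B` holds the plane vectors, `R` their coordinate functions,
and `c` is the coordinate of `b`. -/
theorem exists_planeChart {f c : Fin 4 → K} (hf : f ≠ 0) (hc : c ≠ 0) (hcf : c ⬝ᵥ f = 0) :
    Nonempty (PlaneChart f c) := by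
  let φ : Dual K (Fin 4 → K) := dotProductBilin K K c
  have hφ (x) : φ x = c ⬝ᵥ x := rfl
  obtain ⟨b, hb⟩ : ∃ b, φ b = 1 := by
    have h0 : φ ≠ 0 := by
      intro h
      apply hc
      ext j
      have := hφ (Pi.single j 1)
      simpa [h] using this.symm
    exact (LinearMap.surjective h0) 1
  let f' : LinearMap.ker φ := ⟨f, hcf⟩
  have hf' : f' ≠ 0 := fun h => hf (congrArg Subtype.val h)
  obtain ⟨ψ, hψ⟩ : ∃ ψ : Dual K (LinearMap.ker φ), ψ f' = 1 := by
    obtain ⟨ψ, hψ⟩ : ∃ ψ : Dual K (LinearMap.ker φ), ψ f' ≠ 0 := by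
      by_contra! h
      exact hf' ((forall_dual_apply_eq_zero_iff K f').1 h)
    exact ⟨(ψ f')⁻¹ • ψ, by simp [hψ]⟩
  have h3 : finrank K (LinearMap.ker φ) = 3 := by
    have := φ.finrank_range_add_finrank_ker
    rw [LinearMap.range_eq_top.2 (LinearMap.surjective fun h => by simp [h] at hb)] at this
    simp at this
    omega
  have h2 : finrank K (LinearMap.ker ψ) = 2 := by
    have := ψ.finrank_range_add_finrank_ker
    rw [LinearMap.range_eq_top.2 (LinearMap.surjective fun h => by simp [h] at hψ)] at this
    simp [h3] at this
    omega
  have := Module.Free.of_divisionRing K (LinearMap.ker ψ)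
  let β₂ := Basis.mkFinCons f' (finBasisOfFinrankEq K _ h2)
    (fun a x hx h => by simpa [hψ, LinearMap.mem_ker.1 hx] using congrArg ψ h)
    (fun z => ⟨-ψ z, by simp [hψ]⟩)
  have hβ₂ : β₂ 0 = f' := by simp [β₂]
  let β : Basis (Fin 4) K (Fin 4 → K) := Basis.mkFinCons b β₂
    (fun a x hx h => by simpa [hb, LinearMap.mem_ker.1 hx] using congrArg φ h)
    (fun z => ⟨-φ z, by simp [hb]⟩)
  have hβ0 : β 0 = b := by simp [β]
  have hβs (k : Fin 3) : β k.succ = β₂ k := by simp [β]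
  have hker (k : Fin 3) : φ (β k.succ) = 0 := by rw [hβs]; exact (β₂ k).2
  have hrepr (x) : β.repr x 0 = c ⬝ᵥ x := by
    have := congrArg φ (β.sum_repr x)
    rw [Fin.sum_univ_succ] at this
    simpa only [hker, hβ0, hb, hφ x, map_add, map_smul, map_sum, mul_zero, smul_zero,
      Finset.sum_const_zero, add_zero, smul_eq_mul, mul_one] using this
  refine ⟨⟨Matrix.of fun j k => β k.succ j, Matrix.of fun k j => β.repr (Pi.single j 1) k.succ,
    b, ?_, ?_, ?_, ?_⟩⟩
  · ext j
    have := congrFun (hβs 0) j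
    simp only [hβ₂] at this
    simpa using this
  · ext k
    exact hker k
  · ext k l
    have h := congrArg (fun x => β.repr x k.succ) (pi_eq_sum_univ' (β l.succ))
    simp only [Basis.repr_self, map_sum, map_smul, Finsupp.coe_finsetSum, Finset.sum_apply,
      Finsupp.smul_apply, smul_eq_mul] at h
    simp only [Matrix.mul_apply, Matrix.of_apply, Matrix.one_apply]
    rw [Finsupp.single_apply] at h
    simp only [Fin.succ_inj] at h
    have e : (if k = l then (1 : K) else 0) = if l = k then 1 else 0 := by simp [eq_comm]
    rw [e, h]
    refine Finset.sum_congr rfl fun j _ => ?_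
    rw [mul_comm]
  · ext i j
    have h := congrFun (β.sum_repr (Pi.single j 1)) i
    rw [Fin.sum_univ_succ, hrepr, hβ0] at h
    simp only [Pi.add_apply, Pi.smul_apply, Finset.sum_apply, smul_eq_mul] at h
    simp only [Matrix.add_apply, Matrix.mul_apply, Matrix.of_apply, Matrix.vecMulVec_apply,
      Matrix.one_apply]
    rw [Pi.single_apply] at h
    rw [← h, add_comm]
    congr 1
    · simp [mul_comm]
    · exact Finset.sum_congr rfl fun _ _ => mul_comm _ _

variable {f c : Fin 4 → K} (χ : PlaneChart f c)

/-- Restriction of polynomials to a parametrized plane. -/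
noncomputable def PlaneChart.restrict : MvPolynomial (Fin 4) K →ₐ[K] MvPolynomial (Fin 3) K :=
  aeval fun j => linearForm K (Fin 3) (χ.B j)

theorem PlaneChart.restrict_linearForm (a : Fin 4 → K) :
    χ.restrict (linearForm K (Fin 4) a) = linearForm K (Fin 3) (a ᵥ* χ.B) := by
  rw [restrict, aeval_linearForm]
  simp_rw [← map_smul]
  rw [← map_sum]
  congr 1

/-- Modulo the form `c`, the substitution by `R` undoes restriction, because `B * R` differs from
the identity by `b cᵀ`. -/
theorem PlaneChart.restrict_eq_zero_iff (F : MvPolynomial (Fin 4) K) :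
    χ.restrict F = 0 ↔ linearForm K (Fin 4) c ∣ F := by
  constructor
  · intro h
    rw [← Ideal.mem_span_singleton, ← Ideal.Quotient.eq_zero_iff_mem]
    set I := Ideal.span {linearForm K (Fin 4) c}
    let σ : MvPolynomial (Fin 3) K →ₐ[K] MvPolynomial (Fin 4) K :=
      aeval fun k => linearForm K (Fin 4) (χ.R k)
    have key : (Ideal.Quotient.mkₐ K I).comp (σ.comp χ.restrict) = Ideal.Quotient.mkₐ K I := by
      apply MvPolynomial.algHom_ext
      intro j
      simp only [AlgHom.comp_apply, restrict, aeval_X]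
      rw [Ideal.Quotient.mkₐ_eq_mk, ← sub_eq_zero, ← map_sub, Ideal.Quotient.eq_zero_iff_mem,
        Ideal.mem_span_singleton]
      refine ⟨C (-χ.b j), ?_⟩
      rw [show σ (linearForm K (Fin 3) (χ.B j)) = linearForm K (Fin 4) (χ.B j ᵥ* χ.R) by
        rw [aeval_linearForm]
        simp_rw [← map_smul]
        rw [← map_sum]
        congr 1]
      rw [← linearForm_single, ← map_sub, mul_comm, ← smul_eq_C_mul, ← map_smul]
      congr 1
      ext k
      have := congrFun (congrFun χ.split j) k
      simp only [Matrix.add_apply, Matrix.vecMulVec_apply, Matrix.one_apply] at this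
      simp only [Pi.sub_apply, Pi.smul_apply, smul_eq_mul, Pi.single_apply]
      have e : (χ.B j ᵥ* χ.R) k = (χ.B * χ.R) j k := rfl
      have e' : (if k = j then (1 : K) else 0) = if j = k then 1 else 0 := by simp [eq_comm]
      rw [e, e', ← this]
      ring
    have := DFunLike.congr_fun key F
    simpa [h] using this.symm
  · rintro ⟨G, rfl⟩
    rw [map_mul, restrict_linearForm, χ.vecMul_eq]
    simp

theorem PlaneChart.map_formsAt_of_ne {g : Fin 4 → K} (hg : c ⬝ᵥ g ≠ 0) :
    (formsAt g).map χ.restrict.toLinearMap = homogeneousSubmodule (Fin 3) K 1 := by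
  rw [← range_linearForm]
  apply le_antisymm
  · rintro _ ⟨F, hF, rfl⟩
    obtain ⟨a, -, rfl⟩ := mem_formsAt.1 hF
    exact ⟨_, (χ.restrict_linearForm a).symm⟩
  · rintro _ ⟨y, rfl⟩
    let a := y ᵥ* χ.R
    -- The form `c` restricts to zero, so a multiple of it can be subtracted to make any lift vanish
    -- at `g`.
    refine ⟨linearForm K (Fin 4) (a - (a ⬝ᵥ g / (c ⬝ᵥ g)) • c), linearForm_mem_formsAt ?_, ?_⟩
    · rw [sub_dotProduct, smul_dotProduct, smul_eq_mul, div_mul_cancel₀ _ hg, sub_self]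
    · simp [restrict_linearForm, χ.vecMul_eq, a,
        χ.retract]

theorem PlaneChart.map_formsAt_self :
    (formsAt f).map χ.restrict.toLinearMap = formsAt (Pi.single 0 1) := by
  apply le_antisymm
  · rintro _ ⟨F, hF, rfl⟩
    obtain ⟨a, ha, rfl⟩ := mem_formsAt.1 hF
    refine mem_formsAt.2 ⟨a ᵥ* χ.B, ?_, (χ.restrict_linearForm a).symm⟩
    rw [← Matrix.dotProduct_mulVec, χ.col_zero, ha]
  · intro F hF
    obtain ⟨y, hy, rfl⟩ := mem_formsAt.1 hF
    refine ⟨linearForm K (Fin 4) (y ᵥ* χ.R), linearForm_mem_formsAt ?_, ?_⟩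
    · have h := χ.retract
      rw [← Matrix.dotProduct_mulVec, show χ.R *ᵥ f = Pi.single 0 1 by
        have e := congrArg (χ.R *ᵥ ·) χ.col_zero.symm
        simp only [Matrix.mulVec_mulVec, h, Matrix.one_mulVec] at e
        exact e, hy]
    · simp [restrict_linearForm, χ.retract]

/-- A point of the plane is `y₀ f` plus a combination of the other two columns of `B`. Viewed as a
polynomial in `y₀`, the restriction is therefore a specialization of `translate f F`. -/
theorem PlaneChart.degreeOf_restrict_le (F : MvPolynomial (Fin 4) K) :
    degreeOf 0 (χ.restrict F) ≤ (translate f F).natDegree := by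
  rw [← natDegree_finSuccEquiv]
  let ε : MvPolynomial (Fin 4) K →ₐ[K] MvPolynomial (Fin 2) K :=
    aeval fun j => ∑ k : Fin 2, C (χ.B j k.succ) * X k
  have key : ((finSuccEquiv K 2).toAlgHom).comp χ.restrict =
      (Polynomial.mapAlgHom ε).comp (translate f) := by
    apply MvPolynomial.algHom_ext
    intro j
    have hj : χ.B j 0 = f j := by
      simpa using congrFun χ.col_zero j
    have hC (a : K) : finSuccEquiv K 2 (C a) = Polynomial.C (C a) := by
      rw [← finSuccEquiv_comp_C_eq_C]; simp
    change finSuccEquiv K 2 (χ.restrict (X j)) = Polynomial.map (ε : _ →+* _) (translate f (X j))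
    simp only [PlaneChart.restrict, translate, aeval_X]
    rw [linearForm_apply, Fin.sum_univ_succ]
    simp only [map_add, map_mul, map_sum, hC, finSuccEquiv_X_zero, finSuccEquiv_X_succ,
      Polynomial.map_add, Polynomial.map_mul, Polynomial.map_C, Polynomial.map_X, hj]
    rw [add_comm]
    simp [ε]
  have h : finSuccEquiv K 2 (χ.restrict F) = Polynomial.map (ε : _ →+* _) (translate f F) :=
    DFunLike.congr_fun key F
  rw [h]
  exact Polynomial.natDegree_map_le

theorem PlaneChart.restrict_isHomogeneous {F : MvPolynomial (Fin 4) K} {d : ℕ}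
    (hF : F.IsHomogeneous d) : (χ.restrict F).IsHomogeneous d := by
  have := hF.aeval (fun j => linearForm K (Fin 3) (χ.B j))
    (fun j => linearForm_isHomogeneous _)
  rwa [one_mul] at this

end PlaneCharts

/-! ### Plane forms with a multiple point: dimension and factorization -/

section PlaneForms

variable (K : Type*) [Field K]

/-- Exponents of the monomials of degree `d` in three variables whose degree in the first
variable is at most `m`. -/
def planeExponents (d m : ℕ) : Set (Fin 3 →₀ ℕ) := {s | s.degree = d ∧ s 0 ≤ m}

theorem sum_add_choose (m k : ℕ) :
    ∑ c ∈ Finset.range (m + 1), (k + c + 1) + (k + 1).choose 2 = (m + k + 2).choose 2 := by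
  induction m with
  | zero => simp [Nat.choose_succ_succ' (k + 1) 1]
  | succ m ih =>
    rw [Finset.sum_range_succ, show m + 1 + k + 2 = (m + k + 2) + 1 by ring,
      Nat.choose_succ_succ' (m + k + 2) 1, ← ih, Nat.choose_one_right]
    ring

/-- The term `(k + 1).choose 2` accounts for the excluded monomials of degree `m + k`: those whose
last two exponents sum to less than `k`. -/
theorem ncard_planeExponents (m k : ℕ) :
    (planeExponents (m + k) m).ncard + (k + 1).choose 2 = (m + k + 2).choose 2 := by
  let g : (_ : ℕ) × ℕ × ℕ → Fin 3 →₀ ℕ := fun x =>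
    Finsupp.equivFunOnFinite.symm ![x.1, x.2.1, x.2.2]
  have hg : Function.Injective g := by
    rintro ⟨a, b, c⟩ ⟨a', b', c'⟩ h
    have h := Finsupp.equivFunOnFinite.symm.injective h
    have h0 := congrFun h 0
    have h1 := congrFun h 1
    have h2 := congrFun h 2
    simp at h0 h1 h2
    simp [h0, h1, h2]
  let S : Finset ((_ : ℕ) × ℕ × ℕ) :=
    (Finset.range (m + 1)).sigma fun c => Finset.HasAntidiagonal.antidiagonal (m + k - c)
  have hS : planeExponents (m + k) m = g '' S := by
    ext s
    simp only [planeExponents, Set.mem_ofPred_eq, Set.mem_image, Finset.mem_coe]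
    rw [Finsupp.degree_eq_sum, Fin.sum_univ_three]
    constructor
    · rintro ⟨h1, h2⟩
      refine ⟨⟨s 0, s 1, s 2⟩, ?_, ?_⟩
      · simp only [S, Finset.mem_sigma, Finset.mem_range, Finset.HasAntidiagonal.mem_antidiagonal]
        omega
      · ext j
        fin_cases j <;> rfl
    · rintro ⟨⟨a, b, c⟩, h, rfl⟩
      simp only [S, Finset.mem_sigma, Finset.mem_range, Finset.HasAntidiagonal.mem_antidiagonal] at h
      change a + b + c = _ ∧ a ≤ m
      omega
  rw [hS, Set.ncard_image_of_injective _ hg, Set.ncard_coe_finset, Finset.card_sigma,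
    ← sum_add_choose]
  congr 1
  rw [← Finset.sum_range_reflect]
  refine Finset.sum_congr rfl fun c hc => ?_
  rw [Finset.mem_range] at hc
  rw [Finset.Nat.card_antidiagonal]
  omega

/-- Forms of degree `d` in three variables whose degree in the first variable is at most `m`. -/
noncomputable def planeForms (d m : ℕ) : Submodule K (MvPolynomial (Fin 3) K) :=
  restrictSupport K (planeExponents d m)

theorem finrank_planeForms (m k : ℕ) :
    finrank K (planeForms K (m + k) m) + (k + 1).choose 2 = (m + k + 2).choose 2 := by
  rw [planeForms, finrank_eq_nat_card_basis (basisRestrictSupport K _)]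
  exact ncard_planeExponents m k

variable {K}

theorem mem_planeForms {d m : ℕ} {F : MvPolynomial (Fin 3) K} (hF : F.IsHomogeneous d)
    (h : degreeOf 0 F ≤ m) : F ∈ planeForms K d m := by
  rw [planeForms, mem_restrictSupport_iff]
  intro s hs
  exact ⟨(hF.degree_eq_sum_deg_support hs).symm,
    (monomial_le_degreeOf 0 hs).trans h⟩

/-- A monomial with `X 0`-degree at most `m` has at least `k` factors among `X 1` and `X 2`, which
vanish at the first basis vector. -/
theorem planeForms_le (m k : ℕ) :
    planeForms K (m + k) m ≤
      formsAt (Pi.single (0 : Fin 3) 1) ^ k * homogeneousSubmodule (Fin 3) K 1 ^ m := by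
  have hX (j : Fin 3) : (X j : MvPolynomial (Fin 3) K) ∈ homogeneousSubmodule (Fin 3) K 1 :=
    isHomogeneous_X _ _
  have hX' (j : Fin 3) (hj : j ≠ 0) :
      (X j : MvPolynomial (Fin 3) K) ∈ formsAt (Pi.single (0 : Fin 3) 1) := by
    rw [← linearForm_single]
    exact linearForm_mem_formsAt (by simp [hj.symm])
  rw [planeForms, restrictSupport_eq_span, Submodule.span_le]
  rintro _ ⟨s, ⟨hs, hs0⟩, rfl⟩
  rw [Finsupp.degree_eq_sum, Fin.sum_univ_three] at hs
  have e : (monomial s 1 : MvPolynomial (Fin 3) K) =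
      (X 1 ^ s 1 * X 2 ^ s 2) * X 0 ^ s 0 := by
    rw [monomial_eq, Finsupp.prod_fintype _ _ (by simp), Fin.prod_univ_three]
    simp only [map_one]
    ring
  have h12 : s 1 + s 2 = k + (m - s 0) := by omega
  have h : (monomial s 1 : MvPolynomial (Fin 3) K) ∈
      formsAt (Pi.single (0 : Fin 3) (1 : K)) ^ (s 1 + s 2) *
        homogeneousSubmodule (Fin 3) K 1 ^ s 0 := by
    rw [e, pow_add]
    exact Submodule.mul_mem_mul (Submodule.mul_mem_mul (Submodule.pow_mem_pow _ (hX' 1 (by simp)) _)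
      (Submodule.pow_mem_pow _ (hX' 2 (by simp)) _)) (Submodule.pow_mem_pow _ (hX 0) _)
  have le : formsAt (Pi.single (0 : Fin 3) (1 : K)) ^ (s 1 + s 2) *
        homogeneousSubmodule (Fin 3) K 1 ^ s 0 ≤
      formsAt (Pi.single (0 : Fin 3) 1) ^ k * homogeneousSubmodule (Fin 3) K 1 ^ m := by
    rw [h12, pow_add, mul_assoc]
    refine mul_le_mul' le_rfl ?_
    calc _ ≤ homogeneousSubmodule (Fin 3) K 1 ^ (m - s 0) *
          homogeneousSubmodule (Fin 3) K 1 ^ s 0 :=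
        mul_le_mul' (pow_le_pow_left' (formsAt_le _) _) le_rfl
      _ = _ := by rw [← pow_add, Nat.sub_add_cancel hs0]
  exact le h

end PlaneForms

/-! ### Induction on the multidegree by restriction to planes -/

section Restriction

variable {K : Type*} [Field K]

theorem isHomogeneous_of_linearForm_mul {ι : Type*} [Fintype ι] {c : ι → K} (hc : c ≠ 0)
    {G : MvPolynomial ι K} {d : ℕ} (h : (linearForm K ι c * G).IsHomogeneous (d + 1)) :
    G.IsHomogeneous d := by
  have key : linearForm K ι c * G = linearForm K ι c * homogeneousComponent d G := by
    conv_lhs => rw [← homogeneousComponent_eq_self h]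
    conv_lhs => rw [← sum_homogeneousComponent G]
    rw [Finset.mul_sum, map_sum]
    have hm (e : ℕ) : linearForm K ι c * homogeneousComponent e G ∈
        homogeneousSubmodule ι K (e + 1) :=
      add_comm 1 e ▸ (linearForm_isHomogeneous c).mul (homogeneousComponent_isHomogeneous e G)
    simp_rw [homogeneousComponent_of_mem (hm _)]
    simp only [Nat.add_right_cancel_iff, Finset.sum_ite_eq, Finset.mem_range]
    split_ifs with hd
    · rfl
    · rw [homogeneousComponent_eq_zero _ _ (by omega), mul_zero]
  rw [mul_left_cancel₀ (linearForm_ne_zero hc) key]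
  exact homogeneousComponent_isHomogeneous d G

variable {κ : Type*}

/-- Any two of the vectors `f i` are separated by a linear form. -/
def Separated {ι : Type*} [Fintype ι] (f : κ → ι → K) : Prop :=
  ∀ i j, i ≠ j → ∃ c : ι → K, c ⬝ᵥ f i = 0 ∧ c ⬝ᵥ f j ≠ 0

/-- Over an infinite field, the forms vanishing at `f i` are not a finite union of proper subspaces.
-/
theorem Separated.exists_forall {ι : Type*} [Fintype ι] [Infinite K] [Finite κ] {f : κ → ι → K}
    (hf : Separated f) (i : κ) :
    ∃ c : ι → K, c ⬝ᵥ f i = 0 ∧ ∀ j ≠ i, c ⬝ᵥ f j ≠ 0 := by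
  obtain ⟨c, hc, h⟩ := Dual.exists_forall_mem_ne_zero_of_forall_exists
    (LinearMap.ker (dotProductBilin K K (f i)))
    (fun j : {j // j ≠ i} => dotProductBilin K K (f j)) (fun j => by
      obtain ⟨c, h1, h2⟩ := hf i j j.2.symm
      exact ⟨c, by simpa [dotProduct_comm] using h1, by simpa [dotProduct_comm] using h2⟩)
  exact ⟨c, by simpa [dotProduct_comm] using hc, fun j hj => by
    simpa [dotProduct_comm] using h ⟨j, hj⟩⟩

theorem Separated.exists_planeChart [Infinite K] [Nontrivial κ] [Finite κ] {f : κ → Fin 4 → K}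
    (hf : Separated f) (i : κ) :
    ∃ c : Fin 4 → K, c ≠ 0 ∧ c ⬝ᵥ f i = 0 ∧ (∀ j ≠ i, c ⬝ᵥ f j ≠ 0) ∧
      Nonempty (PlaneChart (f i) c) := by
  obtain ⟨c, h1, h2⟩ := hf.exists_forall i
  obtain ⟨j, hj⟩ := exists_ne i
  have hc : c ≠ 0 := by
    rintro rfl
    exact h2 j hj (zero_dotProduct _)
  have hfi : f i ≠ 0 := by
    intro h
    obtain ⟨c, -, h⟩ := hf j i hj
    simp_all
  exact ⟨c, hc, h1, h2, Multiview.exists_planeChart hfi hc h1⟩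

variable [Fintype κ] [DecidableEq κ] {f : κ → Fin 4 → K}

/-- Dividing by `c` lowers the total degree by one. It also lowers the degree along each `f j`, `j ≠
i`, but not along `f i`, so only the required order at `f i` drops. -/
theorem mem_fatSpace_of_linearForm_mul {ι : Type*} [Fintype ι] {f : κ → ι → K} {i : κ}
    {c : ι → K} (hc : c ≠ 0)
    (hi : c ⬝ᵥ f i = 0) (hj : ∀ j ≠ i, c ⬝ᵥ f j ≠ 0) {u : κ → ℕ} {G : MvPolynomial ι K}
    (h : linearForm K ι c * G ∈ fatSpace f (u + Pi.single i 1)) : G ∈ fatSpace f u := by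
  rw [mem_fatSpace, sum_add_single] at h
  obtain ⟨h1, h2⟩ := h
  refine mem_fatSpace.2 ⟨isHomogeneous_of_linearForm_mul hc h1, fun k => ?_⟩
  have hk := h2 k
  rcases eq_or_ne k i with rfl | hki
  · rw [natDegree_translate_mul_linearForm_of_mem hc hi] at hk
    simp only [Pi.add_apply, Pi.single_eq_same] at hk
    omega
  · rcases eq_or_ne (translate (f k) G) 0 with h0 | h0
    · rw [h0, Polynomial.natDegree_zero, zero_add]
      exact Finset.single_le_sum (f := u) (fun j _ => Nat.zero_le _) (Finset.mem_univ k)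
    rw [natDegree_translate_mul_linearForm (hj k hki) h0] at hk
    simp only [Pi.add_apply, Pi.single_eq_of_ne hki] at hk
    omega

theorem PlaneChart.map_productSpace {i : κ} {c : Fin 4 → K} (χ : PlaneChart (f i) c)
    (hj : ∀ j ≠ i, c ⬝ᵥ f j ≠ 0) (u : κ → ℕ) :
    (productSpace f u).map χ.restrict.toLinearMap =
      formsAt (Pi.single 0 1) ^ u i *
        homogeneousSubmodule (Fin 3) K 1 ^ ∑ j ∈ Finset.univ.erase i, u j := by
  have h : (productSpace f u).map χ.restrict.toLinearMap =
      ∏ k, ((formsAt (f k)).map χ.restrict.toLinearMap) ^ u k := by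
    have := map_prod (Submodule.mapHom χ.restrict) (fun k => formsAt (f k) ^ u k) Finset.univ
    simp only [map_pow] at this
    exact this
  rw [h, ← Finset.mul_prod_erase _ _ (Finset.mem_univ i), χ.map_formsAt_self,
    ← Finset.prod_pow_eq_pow_sum]
  congr 1
  refine Finset.prod_congr rfl fun j hj' => ?_
  rw [χ.map_formsAt_of_ne (hj j (Finset.ne_of_mem_erase hj'))]

theorem PlaneChart.map_fatSpace_le {i : κ} {c : Fin 4 → K} (χ : PlaneChart (f i) c)
    (u : κ → ℕ) :
    (fatSpace f u).map χ.restrict.toLinearMap ≤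
      planeForms K (∑ j ∈ Finset.univ.erase i, u j + u i)
        (∑ j ∈ Finset.univ.erase i, u j) := by
  rintro _ ⟨F, hF, rfl⟩
  obtain ⟨h1, h2⟩ := mem_fatSpace.1 hF
  have e := Finset.sum_erase_add Finset.univ u (Finset.mem_univ i)
  refine mem_planeForms ?_ ?_
  · rw [e]
    exact χ.restrict_isHomogeneous h1
  · have h3 := χ.degreeOf_restrict_le F
    have h4 := h2 i
    change degreeOf 0 (χ.restrict F) ≤ _
    omega

/-- The plane forms lie in the image of the products, which lies in the image of `fatSpace`, which
lies in the plane forms; hence all three agree. -/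
theorem PlaneChart.map_eq_planeForms {i : κ} {c : Fin 4 → K}
    (χ : PlaneChart (f i) c) (u : κ → ℕ) (hj : ∀ j ≠ i, c ⬝ᵥ f j ≠ 0) :
    (productSpace f u).map χ.restrict.toLinearMap =
        planeForms K (∑ j ∈ Finset.univ.erase i, u j + u i)
        (∑ j ∈ Finset.univ.erase i, u j) ∧
      (fatSpace f u).map χ.restrict.toLinearMap =
        (productSpace f u).map χ.restrict.toLinearMap := by
  have h1 := planeForms_le (K := K) (∑ j ∈ Finset.univ.erase i, u j) (u i)
  rw [← χ.map_productSpace hj] at h1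
  have h2 := χ.map_fatSpace_le u
  have h3 := Submodule.map_mono (f := χ.restrict.toLinearMap) (productSpace_le_fatSpace f u)
  exact ⟨le_antisymm (h3.trans h2) h1, le_antisymm (h2.trans h1) h3⟩

variable [Infinite K] [Nontrivial κ]

/-- A form of degree `∑ u` that vanishes to order `u k` at each `f k` is a sum of products of
linear forms. -/
theorem Separated.fatSpace_eq (hf : Separated f) (u : κ → ℕ) :
    fatSpace f u = productSpace f u := by
  induction u using induction_add_single with
  | zero =>
    refine le_antisymm ?_ (productSpace_le_fatSpace _ _)
    rw [productSpace_zero]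
    exact fatSpace_zero_le f
  | add u i ih =>
    obtain ⟨c, hc, hi, hj, ⟨χ⟩⟩ := hf.exists_planeChart i
    refine le_antisymm (fun F hF => ?_) (productSpace_le_fatSpace _ _)
    -- Some `F'` in the product space has the same restriction as `F`, so `c` divides `F - F'`. The
    -- quotient falls under the induction hypothesis.
    have hρ : χ.restrict F ∈
        (productSpace f (u + Pi.single i 1)).map χ.restrict.toLinearMap :=
      (χ.map_eq_planeForms _ hj).2 ▸ Submodule.mem_map_of_mem hF
    obtain ⟨F', hF', h⟩ := hρ
    have h0 : χ.restrict (F - F') = 0 := by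
      rw [map_sub, sub_eq_zero]; exact h.symm
    obtain ⟨G, hG⟩ := (χ.restrict_eq_zero_iff _).1 h0
    have hQ : F - F' ∈ fatSpace f (u + Pi.single i 1) :=
      sub_mem hF (productSpace_le_fatSpace _ _ hF')
    rw [hG] at hQ
    have hG' := mem_fatSpace_of_linearForm_mul hc hi hj hQ
    rw [ih] at hG'
    rw [← sub_add_cancel F F', hG]
    refine add_mem ?_ hF'
    rw [productSpace_add_single]
    exact Submodule.mul_mem_mul (linearForm_mem_formsAt hi) hG'

/-- Rank–nullity for restriction to the plane: the kernel is `c` times `productSpace f u`, the image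
a space of plane forms with `k = u i + 1`. -/
theorem Separated.finrank_add_single (hf : Separated f) (u : κ → ℕ) (i : κ) :
    finrank K (productSpace f (u + Pi.single i 1)) + (u i + 2).choose 2 =
      finrank K (productSpace f u) + (∑ k, u k + 3).choose 2 := by
  obtain ⟨c, hc, hi, hj, ⟨χ⟩⟩ := hf.exists_planeChart i
  set v := u + Pi.single i 1 with hv
  have := finiteDimensional_productSpace f v
  have hrk := (χ.restrict.toLinearMap.domRestrict (productSpace f v)).finrank_range_add_finrank_ker
  have hrange : LinearMap.range (χ.restrict.toLinearMap.domRestrict (productSpace f v)) =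
      (productSpace f v).map χ.restrict.toLinearMap := LinearMap.range_domRestrict _ _
  let μ : MvPolynomial (Fin 4) K →ₗ[K] MvPolynomial (Fin 4) K :=
    LinearMap.mulLeft K (linearForm K (Fin 4) c)
  have hμ : Function.Injective μ := fun a b h => mul_left_cancel₀ (linearForm_ne_zero hc) h
  have hker : (LinearMap.ker (χ.restrict.toLinearMap.domRestrict (productSpace f v))).map
      (productSpace f v).subtype = (productSpace f u).map μ := by
    ext F
    simp only [Submodule.mem_map, LinearMap.mem_ker, LinearMap.domRestrict_apply,
      Submodule.coe_subtype, Subtype.exists, exists_and_right, exists_eq_right]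
    constructor
    · rintro ⟨hF, h0⟩
      obtain ⟨G, rfl⟩ := (χ.restrict_eq_zero_iff _).1 h0
      refine ⟨G, ?_, rfl⟩
      -- Division by `c` is controlled only through vanishing orders, hence the passage to
      -- `fatSpace`.
      rw [← hf.fatSpace_eq] at hF ⊢
      exact mem_fatSpace_of_linearForm_mul hc hi hj hF
    · rintro ⟨G, hG, rfl⟩
      refine ⟨?_, (χ.restrict_eq_zero_iff _).2 ⟨G, rfl⟩⟩
      rw [hv, productSpace_add_single]
      exact Submodule.mul_mem_mul (linearForm_mem_formsAt hi) hG
  have hker' := congrArg (fun W : Submodule K (MvPolynomial (Fin 4) K) => finrank K W) hker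
  rw [← (Submodule.equivMapOfInjective _ (productSpace f v).injective_subtype _).finrank_eq,
    ← (Submodule.equivMapOfInjective μ hμ _).finrank_eq] at hker'
  rw [hrange, hker', (χ.map_eq_planeForms _ hj).1] at hrk
  have hcount := finrank_planeForms K (∑ j ∈ Finset.univ.erase i, v j) (v i)
  have e := Finset.sum_erase_add Finset.univ v (Finset.mem_univ i)
  have e' := sum_add_single u i
  rw [← hv] at e'
  have hvi : v i = u i + 1 := by simp [hv]
  rw [e, e'] at hcount hrk
  rw [hvi] at hcount
  rw [show ∑ k, u k + 3 = ∑ k, u k + 1 + 2 by ring, ← hcount, ← hrk]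
  ring

theorem Separated.finrank_productSpace (hf : Separated f) (u : κ → ℕ) :
    finrank K (productSpace f u) + ∑ i, (u i + 2).choose 3 = (∑ i, u i + 3).choose 3 := by
  induction u using induction_add_single with
  | zero =>
    rw [productSpace_zero, Submodule.one_eq_span, finrank_span_singleton one_ne_zero]
    simp
  | add u i ih =>
    have h := hf.finrank_add_single u i
    rw [sum_add_single]
    have h1 : ∑ k, ((u + Pi.single i 1 : κ → ℕ) k + 2).choose 3 =
        ∑ k, (u k + 2).choose 3 + (u i + 2).choose 2 := by
      rw [← Finset.sum_erase_add _ _ (Finset.mem_univ i),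
        ← Finset.sum_erase_add _ (fun k => (u k + 2).choose 3) (Finset.mem_univ i),
        add_assoc]
      congr 1
      · refine Finset.sum_congr rfl fun j hj => ?_
        simp [Finset.ne_of_mem_erase hj]
      · rw [Pi.add_apply, Pi.single_eq_same, show u i + 1 + 2 = u i + 2 + 1 by ring,
          Nat.choose_succ_succ' _ 2, add_comm]
    rw [h1, show ∑ k, u k + 1 + 3 = ∑ k, u k + 3 + 1 by ring, Nat.choose_succ_succ' _ 2, ← ih]
    omega

end Restriction

/-! ### From the multiview ideal to products of linear forms -/

section CameraMap

variable {K : Type*} [Field K] {n : ℕ}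

/-- The rows are orthogonal to `f`, and both spaces have dimension 3. -/
theorem span_camera_rows {M : Matrix (Fin 3) (Fin 4) K} (hM : M.rank = 3) {f : Fin 4 → K}
    (hf : f ≠ 0) (hMf : M *ᵥ f = 0) :
    Submodule.span K (Set.range fun k => linearForm K (Fin 4) (M k)) = formsAt f := by
  have hrow : Submodule.span K (Set.range M.row) = LinearMap.ker (dotProductBilin K K f) := by
    apply Submodule.eq_of_le_of_finrank_eq
    · rw [Submodule.span_le]
      rintro _ ⟨k, rfl⟩
      exact (dotProduct_comm _ _).trans (congrFun hMf k)
    · rw [← Matrix.rank_eq_finrank_span_row, hM]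
      have h := LinearMap.finrank_range_add_finrank_ker (dotProductBilin K K f)
      rw [LinearMap.range_eq_top.2 (LinearMap.surjective fun h0 => hf (by
        ext j
        have := LinearMap.congr_fun h0 (Pi.single j 1)
        simpa using this))] at h
      simp at h
      omega
  rw [formsAt, ← hrow, Submodule.map_span, ← Set.range_comp]
  rfl

/-- The substitution `F ↦ F (A₁ x, …, Aₙ x)`. -/
noncomputable def cameraHom (A : Fin n → Matrix (Fin 3) (Fin 4) K) :
    CoordRing K n →ₐ[K] MvPolynomial (Fin 4) K :=
  aeval fun p => linearForm K (Fin 4) (A p.1 p.2)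

theorem eval_cameraHom (A : Fin n → Matrix (Fin 3) (Fin 4) K) (x : Fin 4 → K)
    (F : CoordRing K n) :
    eval x (cameraHom A F) = eval (fun p => (A p.1 *ᵥ x) p.2) F := by
  have key : (aeval x : MvPolynomial (Fin 4) K →ₐ[K] K).comp (cameraHom A) =
      aeval fun p => (A p.1 *ᵥ x) p.2 := by
    apply MvPolynomial.algHom_ext
    intro p
    simp only [AlgHom.comp_apply, cameraHom, aeval_X]
    exact eval_linearForm _ _
  exact DFunLike.congr_fun key F

theorem weight_varDegree (d : Fin n × Fin 3 →₀ ℕ) (i : Fin n) :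
    Finsupp.weight (varDegree n) d i = ∑ k, d (i, k) := by
  rw [Finsupp.weight_apply, Finsupp.sum_fintype _ _ (by simp), Fintype.sum_prod_type,
    Finset.sum_apply, Finset.sum_eq_single i]
  · simp [varDegree]
  · intro j _ hj
    simp [varDegree, hj.symm]
  · simp

theorem eval_smul_of_isWeightedHomogeneous {F : CoordRing K n} {u : Fin n → ℕ}
    (hF : IsWeightedHomogeneous (varDegree n) F u) (a : Fin n → K) (v : Fin n × Fin 3 → K) :
    eval (fun p => a p.1 * v p) F = (∏ i, a i ^ u i) * eval v F := by
  rw [eval_eq', eval_eq', Finset.mul_sum]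
  refine Finset.sum_congr rfl fun d hd => ?_
  have hw := hF (mem_support_iff.1 hd)
  have h : ∏ p : Fin n × Fin 3, a p.1 ^ d p = ∏ i, a i ^ u i := by
    rw [Fintype.prod_prod_type]
    refine Finset.prod_congr rfl fun i _ => ?_
    simp only
    rw [Finset.prod_pow_eq_pow_sum, ← weight_varDegree, hw]
  simp_rw [mul_pow]
  rw [Finset.prod_mul_distrib, h]
  ring

theorem subset_zariskiClosure (T : Set (ProdPlanes K n)) : T ⊆ zariskiClosure T :=
  Set.subset_sInter fun _ h => h.2

theorem mem_multiviewIdeal_iff [Infinite K] {A : Fin n → Matrix (Fin 3) (Fin 4) K} (hn : 0 < n)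
    (hA : ∀ i, A i ≠ 0) {F : CoordRing K n} {u : Fin n → ℕ}
    (hF : IsWeightedHomogeneous (varDegree n) F u) :
    F ∈ multiviewIdeal A ↔ cameraHom A F = 0 := by
  constructor
  · intro h
    have hrow (i) : ∃ k, A i k ≠ 0 := by
      by_contra! h0
      exact hA i (funext h0)
    choose k hk using hrow
    -- `G` uses one nonzero row per camera, so wherever `G` is nonzero all `A i *ᵥ x` are nonzero.
    -- Thus `cameraHom A F * G` vanishes everywhere, and over an infinite field it is the zero
    -- polynomial.
    let G : MvPolynomial (Fin 4) K := ∏ i, linearForm K (Fin 4) (A i (k i))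
    have hG : G ≠ 0 := Finset.prod_ne_zero_iff.2 fun i _ => linearForm_ne_zero (hk i)
    refine (mul_eq_zero.1 (?_ : cameraHom A F * G = 0)).resolve_right hG
    apply MvPolynomial.funext
    intro x
    rw [map_mul, map_zero, mul_eq_zero, or_iff_not_imp_right]
    intro hx
    have hx' (i) : (A i *ᵥ x) (k i) ≠ 0 := by
      rw [map_prod] at hx
      have := Finset.prod_ne_zero_iff.1 hx i (Finset.mem_univ i)
      rwa [eval_linearForm] at this
    have hAx (i) : A i *ᵥ x ≠ 0 := fun h0 => hx' i (by rw [h0]; rfl)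
    have hx0 : x ≠ 0 := by
      rintro rfl
      exact hAx ⟨0, hn⟩ (Matrix.mulVec_zero _)
    rw [eval_cameraHom]
    exact h _ (subset_zariskiClosure _ ⟨x, hx0, hAx, rfl⟩) (fun i => A i *ᵥ x)
      fun i => ⟨hAx i, rfl⟩
  · intro h P hP
    -- The zero locus of `F` is itself a closed set, so it suffices that it contains the image;
    -- multihomogeneity handles the choice of representatives.
    refine hP {P | ∀ F' ∈ ({F} : Set (CoordRing K n)), VanishesAt F' P}
      ⟨⟨{F}, ?_, rfl⟩, ?_⟩ F rfl
    · rintro _ rfl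
      exact ⟨u, hF⟩
    · rintro _ ⟨x, -, hAx, rfl⟩ _ rfl v hv
      have hv' (i) : ∃ a : K, a • (A i *ᵥ x) = v i := by
        obtain ⟨h0, h1⟩ := hv i
        exact (Projectivization.mk_eq_mk_iff' K _ _ h0 (hAx i)).1 h1
      choose a ha using hv'
      have e : (fun p : Fin n × Fin 3 => v p.1 p.2) =
          fun p => a p.1 * (A p.1 *ᵥ x) p.2 := by
        ext p
        rw [← ha]
        rfl
      rw [e, eval_smul_of_isWeightedHomogeneous hF a (fun p => (A p.1 *ᵥ x) p.2),
        ← eval_cameraHom, h, map_zero, mul_zero]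

theorem finrank_map_eq_of_ker_eq {V W W' : Type*} [AddCommGroup V] [Module K V]
    [AddCommGroup W] [Module K W] [AddCommGroup W'] [Module K W'] (g : V →ₗ[K] W)
    (h : V →ₗ[K] W') (U : Submodule K V) (hU : ∀ x ∈ U, g x = 0 ↔ h x = 0) :
    finrank K (U.map g) = finrank K (U.map h) := by
  rw [← LinearMap.range_domRestrict, ← LinearMap.range_domRestrict,
    ← (g.domRestrict U).quotKerEquivRange.finrank_eq,
    ← (h.domRestrict U).quotKerEquivRange.finrank_eq]
  have : LinearMap.ker (g.domRestrict U) = LinearMap.ker (h.domRestrict U) := by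
    ext x
    exact hU x x.2
  rw [this]

theorem prod_mem_prod {R κ : Type*} [CommRing R] [Algebra K R] {s : Finset κ}
    {P : κ → Submodule K R} {x : κ → R} (h : ∀ k ∈ s, x k ∈ P k) :
    ∏ k ∈ s, x k ∈ ∏ k ∈ s, P k := by
  classical
  induction s using Finset.induction_on with
  | empty => exact Submodule.one_le.1 le_rfl
  | insert k s hk ih =>
    rw [Finset.prod_insert hk, Finset.prod_insert hk]
    exact Submodule.mul_mem_mul (h k (Finset.mem_insert_self k s))
      (ih fun j hj => h j (Finset.mem_insert_of_mem hj))

/-- This factorization lets an algebra homomorphism be applied factor by factor. -/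
theorem weightedHomogeneousSubmodule_varDegree (u : Fin n → ℕ) :
    weightedHomogeneousSubmodule K (varDegree n) u =
      ∏ i, Submodule.span K (Set.range fun k => (X (i, k) : CoordRing K n)) ^ u i := by
  apply le_antisymm
  · intro F hF
    rw [F.as_sum]
    refine Submodule.sum_mem _ fun d hd => ?_
    have hw := hF (mem_support_iff.1 hd)
    rw [monomial_eq, Finsupp.prod_fintype _ _ (by simp), Fintype.prod_prod_type,
      ← smul_eq_C_mul]
    refine Submodule.smul_mem _ _ (prod_mem_prod fun i _ => ?_)
    rw [← hw, weight_varDegree, ← Finset.prod_pow_eq_pow_sum]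
    exact prod_mem_prod fun k _ =>
      Submodule.pow_mem_pow _ (Submodule.subset_span (Set.mem_range_self k)) _
  · have hpow (i : Fin n) (m : ℕ) :
        Submodule.span K (Set.range fun k => (X (i, k) : CoordRing K n)) ^ m ≤
          weightedHomogeneousSubmodule K (varDegree n) (Pi.single i m) := by
      induction m with
      | zero =>
        rw [pow_zero, Submodule.one_le, Pi.single_zero]
        exact isWeightedHomogeneous_one _ _
      | succ m ih =>
        rw [pow_succ, Pi.single_add]
        refine (mul_le_mul' ih ?_).trans (weightedHomogeneousSubmodule_mul _ _ _)
        rw [Submodule.span_le]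
        rintro _ ⟨k, rfl⟩
        exact isWeightedHomogeneous_X K (varDegree n) (i, k)
    have hprod (s : Finset (Fin n)) :
        ∏ i ∈ s, Submodule.span K (Set.range fun k => (X (i, k) : CoordRing K n)) ^ u i ≤
          weightedHomogeneousSubmodule K (varDegree n) (∑ i ∈ s, Pi.single i (u i)) := by
      induction s using Finset.induction_on with
      | empty =>
        rw [Finset.prod_empty, Submodule.one_le, Finset.sum_empty]
        exact isWeightedHomogeneous_one _ _
      | insert i s hi ih =>
        rw [Finset.prod_insert hi, Finset.sum_insert hi]
        exact (mul_le_mul' (hpow i (u i)) ih).trans (weightedHomogeneousSubmodule_mul _ _ _)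
    have := hprod Finset.univ
    rwa [Finset.univ_sum_single] at this

theorem map_cameraHom {A : Fin n → Matrix (Fin 3) (Fin 4) K} (hA : ∀ i, (A i).rank = 3)
    {f : Fin n → Fin 4 → K} (hf : ∀ i, f i ≠ 0) (hAf : ∀ i, A i *ᵥ f i = 0) (u : Fin n → ℕ) :
    (weightedHomogeneousSubmodule K (varDegree n) u).map (cameraHom A).toLinearMap =
      productSpace f u := by
  have h := map_prod (Submodule.mapHom (cameraHom A))
    (fun i => Submodule.span K (Set.range fun k => (X (i, k) : CoordRing K n)) ^ u i) Finset.univ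
  rw [weightedHomogeneousSubmodule_varDegree]
  refine Eq.trans h (Finset.prod_congr rfl fun i _ => ?_)
  rw [map_pow, ← span_camera_rows (hA i) (hf i) (hAf i)]
  congr 1
  change Submodule.map (cameraHom A).toLinearMap _ = _
  rw [Submodule.map_span, ← Set.range_comp]
  congr 2
  ext k
  simp [cameraHom]

theorem hilbertFunction_multiviewIdeal [Infinite K] {A : Fin n → Matrix (Fin 3) (Fin 4) K}
    (hn : 0 < n) (hA : ∀ i, (A i).rank = 3) {f : Fin n → Fin 4 → K} (hf : ∀ i, f i ≠ 0)
    (hAf : ∀ i, A i *ᵥ f i = 0) (u : Fin n → ℕ) :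
    hilbertFunction (multiviewIdeal A) u = finrank K (productSpace f u) := by
  have hA0 (i) : A i ≠ 0 := by
    intro h
    have := hA i
    simp [h] at this
  rw [hilbertFunction, ← map_cameraHom hA hf hAf]
  refine finrank_map_eq_of_ker_eq _ _ _ fun F hF => ?_
  rw [AlgHom.toLinearMap_apply, AlgHom.toLinearMap_apply, Ideal.Quotient.mkₐ_eq_mk,
    Ideal.Quotient.eq_zero_iff_mem]
  exact mem_multiviewIdeal_iff hn hA0 hF

end CameraMap

/-! ### Distinct and coincident focal points -/

section FocalPoints

variable {K : Type*} [Field K]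

theorem mulVec_rep_focalPoint (M : Matrix (Fin 3) (Fin 4) K) (hM : M.rank = 3) :
    M *ᵥ (focalPoint M hM).rep = 0 := by
  have h : (focalPoint M hM).rep ∈ (focalPoint M hM).submodule := by
    rw [Projectivization.submodule_eq]
    exact Submodule.mem_span_singleton_self _
  rw [focalPoint, Projectivization.submodule_mk''] at h
  exact h

theorem exists_dotProduct_ne_zero {ι : Type*} [Fintype ι] {P Q : ℙ K (ι → K)} (h : P ≠ Q) :
    ∃ c : ι → K, c ⬝ᵥ P.rep = 0 ∧ c ⬝ᵥ Q.rep ≠ 0 := by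
  classical
  by_contra! hc
  obtain ⟨a, ha⟩ := Function.ne_iff.1 P.rep_nonzero
  rw [Pi.zero_apply] at ha
  apply h
  rw [← P.mk_rep, ← Q.mk_rep, eq_comm, Projectivization.mk_eq_mk_iff']
  refine ⟨Q.rep a / P.rep a, ?_⟩
  ext b
  -- The `2 × 2` minors with `P.rep` are forms vanishing at `P`; if they also vanish at `Q`, the two
  -- vectors are proportional.
  have hb := hc (Pi.single b (P.rep a) - Pi.single a (P.rep b))
    (by simp [sub_dotProduct, mul_comm])
  simp only [sub_dotProduct, single_dotProduct] at hb
  rw [Pi.smul_apply, smul_eq_mul]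
  field_simp
  linear_combination -hb

/-- By commutativity the products of generators are indexed by unordered pairs from `Fin 3`, of
which there are 6. -/
theorem finrank_mul_self_le {R : Type*} [CommRing R] [Algebra K R] (g : Fin 3 → R) :
    finrank K (Submodule.span K (Set.range g) * Submodule.span K (Set.range g) :
      Submodule K R) ≤ 6 := by
  have h : (Submodule.span K (Set.range g) * Submodule.span K (Set.range g) : Submodule K R) =
      Submodule.span K (Set.range fun s : Sym2 (Fin 3) => (s.map g).mul) := by
    rw [Submodule.span_mul_span]
    congr 1
    ext x
    constructor
    · rintro ⟨_, ⟨a, rfl⟩, _, ⟨b, rfl⟩, rfl⟩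
      exact ⟨s(a, b), rfl⟩
    · rintro ⟨s, rfl⟩
      induction s with
      | _ a b => exact ⟨_, ⟨a, rfl⟩, _, ⟨b, rfl⟩, rfl⟩
  rw [h]
  refine (finrank_range_le_card _).trans_eq ?_
  rw [Sym2.card]
  rfl

end FocalPoints

end Multiview

theorem theorem3p4 {K : Type*} [Field K] [IsAlgClosed K] (n : ℕ) (hn : 2 ≤ n)
    (A : Fin n → Matrix (Fin 3) (Fin 4) K) (hA : ∀ i, (A i).rank = 3) :
    (∀ u : Fin n → ℕ,
      (Multiview.hilbertFunction (Multiview.multiviewIdeal A) u : ℤ) =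
        (((∑ i, u i) + 3).choose 3 : ℤ) - ∑ i, ((u i + 2).choose 3 : ℤ)) ↔
    ∀ i j : Fin n, i ≠ j →
      Multiview.focalPoint (A i) (hA i) ≠ Multiview.focalPoint (A j) (hA j) := by
  have : Infinite K := IsAlgClosed.instInfinite
  have : Nontrivial (Fin n) := Fin.nontrivial_iff_two_le.2 hn
  let f : Fin n → Fin 4 → K := fun i => (Multiview.focalPoint (A i) (hA i)).rep
  have hf (i) : f i ≠ 0 := Projectivization.rep_nonzero _
  have hAf (i) : A i *ᵥ f i = 0 := Multiview.mulVec_rep_focalPoint _ _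
  simp_rw [Multiview.hilbertFunction_multiviewIdeal (by omega) hA hf hAf]
  constructor
  · intro h i j hij hP
    have hji : f j = f i := congrArg Projectivization.rep hP.symm
    -- At `e_i + e_j` the formula gives `5.choose 3 - 2 = 8`, exceeding the bound 6 for the square
    -- of a space with three generators.
    have h1 := h (0 + Pi.single j 1 + Pi.single i 1)
    rw [Multiview.productSpace_add_single, Multiview.productSpace_add_single,
      Multiview.productSpace_zero, mul_one, hji,
      ← Multiview.span_camera_rows (hA i) (hf i) (hAf i), Multiview.sum_add_single,
      Multiview.sum_add_single] at h1
    have h2 := Multiview.finrank_mul_self_le (K := K)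
      fun k => Multiview.linearForm K (Fin 4) (A i k)
    have h3 : ∑ k, ((((0 + Pi.single j 1 + Pi.single i 1 : Fin n → ℕ) k + 2).choose 3 : ℕ) : ℤ) =
        2 := by
      rw [Fintype.sum_eq_add i j hij]
      · simp [hij, hij.symm]
      · rintro k ⟨hki, hkj⟩
        simp [hki, hkj]
    rw [h3] at h1
    simp [Nat.choose] at h1
    omega
  · intro h u
    have hsep : Multiview.Separated f := fun i j hij =>
      Multiview.exists_dotProduct_ne_zero (h i j hij)
    have := hsep.finrank_productSpace u
    rw [eq_sub_iff_add_eq]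
    exact_mod_cast this
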